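/- Let $d, m \in \mathbb{N} = \{0,1,2,\ldots\}$ and $\alpha \in (0,1]$. For an open set $V \subseteq \mathbb{R}^n$, let $\mathcal{C}^{0,\alpha}(V)$ be the set of all functions $g : V \to \mathbb{R}$ such that $$\sup_{x,\,x+h \in K,\; h \neq 0} \frac{|g(x+h)-g(x)|}{|h|^\alpha} < \infty \quad \text{for every compact } K \subseteq V,$$ and let $\mathcal{C}^{m,\alpha}(V)$ be the set of all $g : V \to \mathbb{R}$ of class $\mathcal{C}^m$ all of whose partial derivatives $\partial^\gamma g$ of order $|\gamma| = m$ belong to $\mathcal{C}^{0,\alpha}(V)$. Let $f : U \to \mathbb{R}$ be a function defined on an open subset $U \subseteq \mathbb{R}^d$. The following conditions are equivalent: 1. $f \circ c \in \mathcal{C}^{m,\alpha}(\mathbb{R})$ for each $\mathcal{C}^\infty$-curve $c : \mathbb{R} \to \mathbb{R}^d$ with $c(\mathbb{R}) \subseteq U$. 2. $f \in \mathcal{C}^{m,\alpha}(U)$. -/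

import Mathlib

open scoped ContDiff

/-- The partial derivative `∂ⱼ f` with respect to the `j`-th standard coordinate of `ℝ^d`. -/
noncomputable def coordPartial {d : ℕ} (j : Fin d) (f : EuclideanSpace ℝ (Fin d) → ℝ) :
    EuclideanSpace ℝ (Fin d) → ℝ :=
  fun x => lineDeriv ℝ f x (EuclideanSpace.single j (1 : ℝ))

/-- For a multiindex `γ ∈ ℕ^d`, the derivative `f^(γ) = ∂₁^γ₁ (∂₂^γ₂ ( ⋯ (∂_d^γ_d f)))`.
At the points of an open set its values depend only on the restriction of `f` to that set. -/
noncomputable def multiPartial {d : ℕ} (γ : Fin d → ℕ) (f : EuclideanSpace ℝ (Fin d) → ℝ) :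
    EuclideanSpace ℝ (Fin d) → ℝ :=
  (List.finRange d).foldr (fun j g => (coordPartial j)^[γ j] g) f

/-- `g ∈ C^{0,α}(U)`: on every compact subset `K` of `U` the quotients
`|g y - g x| / |y - x|^α`, for `x ≠ y` in `K`, are bounded (here `α > 0`). -/
def LocHolderOn {X : Type*} [PseudoMetricSpace X] (α : ℝ) (U : Set X) (g : X → ℝ) : Prop :=
  ∀ K : Set X, K ⊆ U → IsCompact K →
    ∃ C : ℝ, ∀ x ∈ K, ∀ y ∈ K, |g y - g x| ≤ C * dist y x ^ α

/-- `f ∈ C^{m,α}(U)` for an open set `U ⊆ ℝ^d`: `f` is of class `C^m` on `U` and all its partial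
derivatives of order exactly `m` belong to `C^{0,α}(U)`. Only `f` restricted to `U` matters. -/
def MemHolderClassOn {d : ℕ} (m : ℕ) (α : ℝ) (U : Set (EuclideanSpace ℝ (Fin d)))
    (f : EuclideanSpace ℝ (Fin d) → ℝ) : Prop :=
  ContDiffOn ℝ m f U ∧
    ∀ γ : Fin d → ℕ, ∑ j, γ j = m → LocHolderOn α U (multiPartial γ f)

/-- `g ∈ C^{m,α}(ℝ)` for a function of one real variable: `g` is of class `C^m` and its `m`-th
derivative belongs to `C^{0,α}(ℝ)`. -/
def MemHolderClassReal (m : ℕ) (α : ℝ) (g : ℝ → ℝ) : Prop :=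
  ContDiff ℝ m g ∧ LocHolderOn α Set.univ (iteratedDeriv m g)

open Set Filter Topology

/-! Membership in `C^{m,α}` passes to curves by the chain rule: `(f ∘ c)'` is a sum of products
`(∂ⱼf ∘ c) · cⱼ'` with smooth second factors, so induction on `m` reduces to a Hölder function
composed with a locally Lipschitz curve (`HolderDiff.comp_curve`).

For the converse, the class is reached through Taylor approximation: polynomials `P x` with `f (x +
h) - P x h = O(‖h‖ ^ (m + α))`, locally uniformly in `x`. Taylor's formula for `f ∘ c`, with `c`
running through a segment, gives a Peano polynomial of `f` on every ray. If the remainder bound were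
not locally uniform, one smooth curve through a sequence of rapidly shrinking bad segments would
contradict the one-variable estimate (`exists_uniform_taylor_bound`). Evaluating the ray polynomials
at `1` defines `P x`; comparison with expansions at nearby base points shows that `P x` is
polynomial on lines (`interpolatedOnLines_of_isPeano`).

Then a converse Taylor theorem applies. The derivative of a polynomial of bounded degree is a fixed
combination of its values at finitely many nodes, so `∂ⱼf` inherits the approximation with `m`
lowered by one (`TaylorApprox.coordPartial`); at `m = 0` a Hölder bound remains
(`TaylorApprox.locHolderOn`). Polynomiality enters only as exactness of Lagrange interpolation on
lines. -/

/-! ### Interpolation, and polynomials small at zero -/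

/-- Polynomial interpolation weights for the nodes `0, 1, …, N`. -/
noncomputable def lagrangeWeight (N j : ℕ) (s : ℝ) : ℝ :=
  (Lagrange.basis (Finset.range (N + 1)) (fun i : ℕ => (i : ℝ)) j).eval s

lemma contDiff_lagrangeWeight (N j : ℕ) {n : WithTop ℕ∞} : ContDiff ℝ n (lagrangeWeight N j) := by
  have h := Polynomial.contDiff_aeval (𝕜 := ℝ) (R := ℝ)
    (Lagrange.basis (Finset.range (N + 1)) (fun i : ℕ => (i : ℝ)) j) n
  simp only [Polynomial.coe_aeval_eq_eval] at h
  exact h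

lemma eval_eq_sum_lagrangeWeight {N : ℕ} {p : Polynomial ℝ} (hp : p.natDegree ≤ N) (s : ℝ) :
    p.eval s = ∑ j ∈ Finset.range (N + 1), lagrangeWeight N j s * p.eval (j : ℝ) := by
  have h := Lagrange.eq_interpolate (s := Finset.range (N + 1)) (v := fun i : ℕ => (i : ℝ)) (f := p)
    (fun a _ b _ h => by simpa using h) (by
      rw [Finset.card_range]
      exact lt_of_le_of_lt Polynomial.degree_le_natDegree (by exact_mod_cast Nat.lt_succ_of_le hp))
  conv_lhs => rw [h]
  simp [Lagrange.interpolate_apply, Polynomial.eval_finsetSum, lagrangeWeight, mul_comm]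

/-- A polynomial of degree at most `m` that is `o(s ^ m)` at `0⁺` vanishes. -/
lemma Polynomial.eq_zero_of_isLittleO_pow {m : ℕ} {p : Polynomial ℝ} (hp : p.natDegree ≤ m)
    (h : (fun s => p.eval s) =o[𝓝[≥] (0 : ℝ)] fun s => s ^ m) : p = 0 := by
  have hlim : ∀ k : ℕ, ∀ q : Polynomial ℝ,
      ((fun s => q.eval s) =o[𝓝[>] (0 : ℝ)] fun s => s ^ k) → q.eval 0 = 0 := by
    intro k q hq
    have h1 : (fun s : ℝ => s ^ k) =O[𝓝[>] (0 : ℝ)] fun _ => (1 : ℝ) := by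
      have : Tendsto (fun s : ℝ => s ^ k) (𝓝[>] 0) (𝓝 (0 ^ k)) :=
        ((continuous_pow k).tendsto 0).mono_left nhdsWithin_le_nhds
      exact this.isBigO_one ℝ
    have h2 := (Asymptotics.isLittleO_one_iff ℝ).1 (hq.trans_isBigO h1)
    exact tendsto_nhds_unique ((q.continuous.tendsto 0).mono_left nhdsWithin_le_nhds) h2
  -- Away from `s = 0` a factor `s` can be cancelled, which drives the induction `p = X * q`.
  have h' := h.mono (nhdsWithin_mono 0 Ioi_subset_Ici_self)
  clear h
  induction m generalizing p with
  | zero =>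
    have h0 := hlim _ p h'
    rw [Polynomial.eq_C_of_natDegree_le_zero hp] at h0 ⊢
    simpa using h0
  | succ m ih =>
    have h0 := hlim _ p h'
    obtain ⟨q, rfl⟩ : Polynomial.X ∣ p := by
      rwa [Polynomial.X_dvd_iff, Polynomial.coeff_zero_eq_eval_zero]
    by_cases hq : q = 0
    · simp [hq]
    rw [ih (p := q) _ _, mul_zero]
    · rw [Polynomial.natDegree_X_mul hq] at hp
      omega
    · rw [Asymptotics.isLittleO_iff] at h' ⊢
      intro c hc
      filter_upwards [h' hc, self_mem_nhdsWithin] with s hs hs0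
      have hs0 : 0 < s := hs0
      simp only [Polynomial.eval_mul, Polynomial.eval_X, norm_mul, pow_succ'] at hs
      have : 0 < ‖s‖ := norm_pos_iff.2 hs0.ne'
      rw [mul_left_comm] at hs
      exact le_of_mul_le_mul_left hs this

/-! ### Locally Hölder functions -/

/-- Local Hölder estimates near each point of `U` give Hölder estimates on compact sets. -/
lemma locHolderOn_of_forall_nhds {X : Type*} [PseudoMetricSpace X] {α : ℝ} (hα : 0 < α)
    {U : Set X} {f : X → ℝ}
    (h : ∀ x₀ ∈ U, ∃ V ∈ 𝓝 x₀, ∃ C : ℝ, ∀ x ∈ V, ∀ y ∈ V, |f y - f x| ≤ C * dist y x ^ α) :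
    LocHolderOn α U f := by
  intro K hKU hK
  have hcont : ∀ x₀ ∈ U, ∃ V ∈ 𝓝 x₀, ∀ x ∈ V, |f x - f x₀| ≤ 1 := by
    intro x₀ hx₀
    obtain ⟨V, hV, C, hC⟩ := h x₀ hx₀
    have ht : Tendsto (fun x => C * dist x x₀ ^ α) (𝓝 x₀) (𝓝 0) := by
      have h1 : Tendsto (fun x => dist x x₀) (𝓝 x₀) (𝓝 0) :=
        tendsto_iff_dist_tendsto_zero.1 tendsto_id
      have h2 := (h1.rpow_const (p := α) (Or.inr hα.le)).const_mul C
      simpa [Real.zero_rpow hα.ne'] using h2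
    refine ⟨V ∩ {x | C * dist x x₀ ^ α < 1}, inter_mem hV (ht.eventually (gt_mem_nhds one_pos)), ?_⟩
    rintro x ⟨hx, hx1⟩
    exact (hC x₀ (mem_of_mem_nhds hV) x hx).trans (le_of_lt hx1)
  have key : ∃ C : ℝ, ∀ p ∈ K ×ˢ K, |f p.2 - f p.1| ≤ C * dist p.2 p.1 ^ α := by
    -- Compactness of `K ×ˢ K`: near a pair at distance zero the hypothesis applies; near any other
    -- pair `f` is bounded and the distance is bounded below.
    refine (hK.prod hK).induction_on (p := fun S => ∃ C : ℝ, ∀ p ∈ S,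
      |f p.2 - f p.1| ≤ C * dist p.2 p.1 ^ α) ⟨0, by simp⟩ ?_ ?_ ?_
    · rintro s t hst ⟨C, hC⟩
      exact ⟨C, fun p hp => hC p (hst hp)⟩
    · rintro s t ⟨C, hC⟩ ⟨C', hC'⟩
      refine ⟨max C C', ?_⟩
      rintro p (hp | hp)
      · exact (hC p hp).trans (by gcongr; exact le_max_left _ _)
      · exact (hC' p hp).trans (by gcongr; exact le_max_right _ _)
    · rintro ⟨x, y⟩ ⟨hx, hy⟩
      by_cases hxy : dist y x = 0
      · obtain ⟨V, hV, C, hC⟩ := h x (hKU hx)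
        have hV' : V ∈ 𝓝 y := by
          have : Inseparable x y := Metric.inseparable_iff.2 (by rwa [dist_comm])
          rwa [← this.nhds_eq]
        exact ⟨V ×ˢ V, mem_nhdsWithin_of_mem_nhds (prod_mem_nhds hV hV'), C,
          fun p hp => hC p.1 hp.1 p.2 hp.2⟩
      · obtain ⟨V, hV, hC⟩ := hcont x (hKU hx)
        obtain ⟨W, hW, hC'⟩ := hcont y (hKU hy)
        have hδ : 0 < dist y x := lt_of_le_of_ne dist_nonneg (Ne.symm hxy)
        set δ := dist y x / 2 with hδd
        have hT : {p : X × X | δ < dist p.2 p.1} ∈ 𝓝 (x, y) := by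
          have : Continuous fun p : X × X => dist p.2 p.1 := by fun_prop
          exact this.continuousAt.eventually (lt_mem_nhds (by simp [hδd]; linarith))
        refine ⟨(V ×ˢ W) ∩ {p : X × X | δ < dist p.2 p.1},
          mem_nhdsWithin_of_mem_nhds (inter_mem (prod_mem_nhds hV hW) hT),
          (2 + |f y - f x|) / δ ^ α, ?_⟩
        rintro p ⟨⟨hp1, hp2⟩, hp3⟩
        have e1 := hC p.1 hp1
        have e2 := hC' p.2 hp2
        have hδ0 : 0 < δ := by positivity
        have hp3 : δ < dist p.2 p.1 := hp3
        have e3 : δ ^ α ≤ dist p.2 p.1 ^ α := Real.rpow_le_rpow hδ0.le hp3.le hα.le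
        have e4 : |f p.2 - f p.1| ≤ 2 + |f y - f x| := by
          have := abs_add_three (f p.2 - f y) (f y - f x) (f x - f p.1)
          rw [abs_sub_comm (f x)] at this
          have e : f p.2 - f p.1 = f p.2 - f y + (f y - f x) + (f x - f p.1) := by ring
          rw [e]; linarith
        calc |f p.2 - f p.1| ≤ 2 + |f y - f x| := e4
          _ = (2 + |f y - f x|) / δ ^ α * δ ^ α := by
            field_simp
          _ ≤ _ := by gcongr
  obtain ⟨C, hC⟩ := key
  exact ⟨C, fun x hx y hy => hC (x, y) ⟨hx, hy⟩⟩

lemma LocHolderOn.congr {X : Type*} [PseudoMetricSpace X] {α : ℝ} {U : Set X} {f g : X → ℝ}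
    (hf : LocHolderOn α U f) (h : EqOn g f U) : LocHolderOn α U g := by
  intro K hKU hK
  obtain ⟨C, hC⟩ := hf K hKU hK
  exact ⟨C, fun x hx y hy => by rw [h (hKU hx), h (hKU hy)]; exact hC x hx y hy⟩

lemma LocHolderOn.continuousOn {X : Type*} [PseudoMetricSpace X] [LocallyCompactSpace X] {α : ℝ}
    (hα : 0 < α) {U : Set X} (hU : IsOpen U) {f : X → ℝ} (hf : LocHolderOn α U f) :
    ContinuousOn f U := by
  intro x₀ hx₀
  obtain ⟨K, hK, hKU, hKc⟩ := local_compact_nhds (hU.mem_nhds hx₀)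
  obtain ⟨C, hC⟩ := hf K hKU hKc
  have h1 : Tendsto (fun x => dist x x₀) (𝓝 x₀) (𝓝 0) := tendsto_iff_dist_tendsto_zero.1 tendsto_id
  have h2 := (h1.rpow_const (p := α) (Or.inr hα.le)).const_mul C
  rw [Real.zero_rpow hα.ne', mul_zero] at h2
  refine ContinuousAt.continuousWithinAt ?_
  refine tendsto_iff_dist_tendsto_zero.2 (squeeze_zero' (Eventually.of_forall fun _ => dist_nonneg)
    ?_ h2)
  filter_upwards [hK] with x hx
  rw [Real.dist_eq]
  exact hC x₀ (mem_of_mem_nhds hK) x hx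

/-! ### The Hölder classes on the real line -/

/-- Functions of one variable whose `m`-th derivative exists and is locally Hölder. -/
def HolderDiffReal (α : ℝ) : ℕ → (ℝ → ℝ) → Prop
  | 0, g => LocHolderOn α univ g
  | m + 1, g => Differentiable ℝ g ∧ HolderDiffReal α m (deriv g)

lemma memHolderClassReal_iff {α : ℝ} (hα : 0 < α) {m : ℕ} {g : ℝ → ℝ} :
    MemHolderClassReal m α g ↔ HolderDiffReal α m g := by
  induction m generalizing g with
  | zero =>
    simp only [MemHolderClassReal, HolderDiffReal, iteratedDeriv_zero, Nat.cast_zero, contDiff_zero]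
    exact and_iff_right_of_imp fun h => continuousOn_univ.1 (h.continuousOn hα isOpen_univ)
  | succ m ih =>
    rw [HolderDiffReal, ← ih, MemHolderClassReal, MemHolderClassReal, iteratedDeriv_succ']
    push_cast
    rw [contDiff_succ_iff_deriv]
    simp [and_assoc]

lemma locHolderOn_of_locallyLipschitz {α : ℝ} (hα₁ : α ≤ 1) {X : Type*}
    [PseudoMetricSpace X] {f : X → ℝ} (hf : LocallyLipschitz f) (hα : 0 < α) {U : Set X} :
    LocHolderOn α U f := by
  refine locHolderOn_of_forall_nhds hα fun x₀ _ => ?_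
  obtain ⟨C, V, hV, hC⟩ := hf x₀
  -- Radius `1 / 2` keeps distances at most `1`, where `dist ≤ dist ^ α`.
  refine ⟨V ∩ Metric.ball x₀ (1 / 2), inter_mem hV (Metric.ball_mem_nhds _ (by norm_num)), C, ?_⟩
  rintro x ⟨hx, hx1⟩ y ⟨hy, hy1⟩
  have h1 := hC.dist_le_mul y hy x hx
  rw [Real.dist_eq] at h1
  refine h1.trans ?_
  have h2 : dist y x ≤ 1 := by
    have := dist_triangle_right y x x₀
    simp only [Metric.mem_ball] at hx1 hy1
    linarith
  gcongr
  rcases (dist_nonneg (x := y) (y := x)).eq_or_lt with h0 | h0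
  · rw [← h0]; positivity
  · calc dist y x = dist y x ^ (1 : ℝ) := (Real.rpow_one _).symm
      _ ≤ _ := Real.rpow_le_rpow_of_exponent_ge h0 h2 hα₁

lemma LocHolderOn.add {X : Type*} [PseudoMetricSpace X] {α : ℝ} {U : Set X} {f g : X → ℝ}
    (hf : LocHolderOn α U f) (hg : LocHolderOn α U g) : LocHolderOn α U fun x => f x + g x := by
  intro K hKU hK
  obtain ⟨C, hC⟩ := hf K hKU hK
  obtain ⟨D, hD⟩ := hg K hKU hK
  refine ⟨C + D, fun x hx y hy => ?_⟩
  rw [add_mul, add_sub_add_comm]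
  exact (abs_add_le _ _).trans (add_le_add (hC x hx y hy) (hD x hx y hy))

lemma LocHolderOn.mul {X : Type*} [PseudoMetricSpace X] {α : ℝ} {U : Set X} {f g : X → ℝ}
    (hf : LocHolderOn α U f) (hg : LocHolderOn α U g) (hfc : ContinuousOn f U)
    (hgc : ContinuousOn g U) : LocHolderOn α U fun x => f x * g x := by
  intro K hKU hK
  obtain ⟨C, hC⟩ := hf K hKU hK
  obtain ⟨D, hD⟩ := hg K hKU hK
  obtain ⟨A, hA⟩ := hK.exists_bound_of_continuousOn (hfc.mono hKU)
  obtain ⟨B, hB⟩ := hK.exists_bound_of_continuousOn (hgc.mono hKU)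
  refine ⟨C * B + A * D, fun x hx y hy => ?_⟩
  have e : f y * g y - f x * g x = (f y - f x) * g y + f x * (g y - g x) := by ring
  rw [e]
  refine (abs_add_le _ _).trans ?_
  rw [abs_mul, abs_mul]
  have h1 := mul_le_mul (hC x hx y hy) (hB y hy) (norm_nonneg _) ((abs_nonneg _).trans (hC x hx y hy))
  have h2 := mul_le_mul (hA x hx) (hD x hx y hy) (abs_nonneg _) ((norm_nonneg _).trans (hA x hx))
  rw [Real.norm_eq_abs] at h1 h2
  nlinarith

lemma HolderDiffReal.continuous {α : ℝ} (hα : 0 < α) {m : ℕ} {g : ℝ → ℝ}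
    (hg : HolderDiffReal α m g) : Continuous g :=
  ((memHolderClassReal_iff hα).2 hg).1.continuous

lemma HolderDiffReal.of_succ {α : ℝ} (hα : 0 < α) (hα₁ : α ≤ 1) {m : ℕ} {g : ℝ → ℝ}
    (hg : HolderDiffReal α (m + 1) g) : HolderDiffReal α m g := by
  induction m generalizing g with
  | zero =>
    refine locHolderOn_of_locallyLipschitz hα₁ (ContDiff.locallyLipschitz (𝕂 := ℝ) ?_) hα
    exact contDiff_one_iff_deriv.2 ⟨hg.1, HolderDiffReal.continuous hα hg.2⟩
  | succ m ih => exact ⟨hg.1, ih hg.2⟩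

lemma HolderDiffReal.add {α : ℝ} {m : ℕ} {f g : ℝ → ℝ}
    (hf : HolderDiffReal α m f) (hg : HolderDiffReal α m g) :
    HolderDiffReal α m fun t => f t + g t := by
  induction m generalizing f g with
  | zero => exact LocHolderOn.add hf hg
  | succ m ih =>
    refine ⟨hf.1.add hg.1, ?_⟩
    have : deriv (fun t => f t + g t) = fun t => deriv f t + deriv g t :=
      funext fun t => deriv_fun_add (hf.1 t) (hg.1 t)
    rw [this]
    exact ih hf.2 hg.2

/-- Leibniz rule; the term with `deriv g` keeps `f` undifferentiated, hence the appeal to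
`HolderDiffReal.of_succ`. -/
lemma HolderDiffReal.mul_contDiff {α : ℝ} (hα : 0 < α) (hα₁ : α ≤ 1) {m : ℕ} {f g : ℝ → ℝ}
    (hf : HolderDiffReal α m f) (hg : ContDiff ℝ ∞ g) :
    HolderDiffReal α m fun t => f t * g t := by
  induction m generalizing f g with
  | zero =>
    exact LocHolderOn.mul hf
      (locHolderOn_of_locallyLipschitz hα₁ (hg.of_le (by simp)).locallyLipschitz hα)
      (hf.continuous hα).continuousOn hg.continuous.continuousOn
  | succ m ih =>
    have hgd : Differentiable ℝ g := hg.differentiable (by simp)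
    refine ⟨hf.1.mul hgd, ?_⟩
    have : deriv (fun t => f t * g t) = fun t => deriv f t * g t + f t * deriv g t :=
      funext fun t => deriv_fun_mul (hf.1 t) (hgd t)
    rw [this]
    exact (ih hf.2 hg).add (ih (hf.of_succ hα hα₁) (contDiff_infty_iff_deriv.1 hg).2)

lemma HolderDiffReal.zero {α : ℝ} {m : ℕ} : HolderDiffReal α m fun _ => 0 := by
  induction m with
  | zero => exact fun K _ _ => ⟨0, by simp⟩
  | succ m ih => exact ⟨differentiable_const _, by simpa using ih⟩

lemma HolderDiffReal.sum {α : ℝ} {m : ℕ} {ι : Type*} (s : Finset ι)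
    {f : ι → ℝ → ℝ} (hf : ∀ i ∈ s, HolderDiffReal α m (f i)) :
    HolderDiffReal α m fun t => ∑ i ∈ s, f i t := by
  classical
  induction s using Finset.induction_on with
  | empty => simpa using HolderDiffReal.zero
  | insert a s ha ih =>
    simp only [Finset.sum_insert ha]
    exact (hf a (by simp)).add (ih fun i hi => hf i (by simp [hi]))

/-! ### Partial derivatives and the easy direction -/

/-- Functions on `U ⊆ ℝ^d` all of whose `m`-fold iterated coordinate derivatives, in any order,
exist and are locally Hölder. -/
def HolderDiff {d : ℕ} (α : ℝ) (U : Set (EuclideanSpace ℝ (Fin d))) :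
    ℕ → (EuclideanSpace ℝ (Fin d) → ℝ) → Prop
  | 0, f => LocHolderOn α U f
  | m + 1, f => DifferentiableOn ℝ f U ∧ ∀ j, HolderDiff α U m (coordPartial j f)

/-- The iterated coordinate derivative along a list of indices, the head being taken last. -/
noncomputable def listPartial {d : ℕ} (l : List (Fin d)) (f : EuclideanSpace ℝ (Fin d) → ℝ) :
    EuclideanSpace ℝ (Fin d) → ℝ :=
  l.foldr coordPartial f

section Partials

variable {d : ℕ} {α : ℝ} {U : Set (EuclideanSpace ℝ (Fin d))} {f g : EuclideanSpace ℝ (Fin d) → ℝ}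

lemma multiPartial_eq_listPartial (γ : Fin d → ℕ) (f : EuclideanSpace ℝ (Fin d) → ℝ) :
    multiPartial γ f = listPartial ((List.finRange d).flatMap fun j => List.replicate (γ j) j) f := by
  unfold multiPartial listPartial
  induction List.finRange d with
  | nil => rfl
  | cons a l ih =>
    rw [List.foldr_cons, List.flatMap_cons, List.foldr_append, ih]
    generalize List.foldr coordPartial f _ = F
    induction γ a with
    | zero => rfl
    | succ n ih' => rw [Function.iterate_succ_apply', List.replicate_succ, List.foldr_cons, ih']

lemma EuclideanSpace.sum_smul_single (y : EuclideanSpace ℝ (Fin d)) :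
    ∑ j, y j • EuclideanSpace.single j (1 : ℝ) = y := by
  simpa using (EuclideanSpace.basisFun (Fin d) ℝ).sum_repr y

lemma fderiv_apply_eq_sum {x : EuclideanSpace ℝ (Fin d)} (hf : DifferentiableAt ℝ f x)
    (y : EuclideanSpace ℝ (Fin d)) : fderiv ℝ f x y = ∑ j, y j * coordPartial j f x := by
  conv_lhs => rw [← EuclideanSpace.sum_smul_single y]
  simp [coordPartial, hf.lineDeriv_eq_fderiv]

lemma contDiffOn_succ_iff_coordPartial (hU : IsOpen U) {n : ℕ} :
    ContDiffOn ℝ (n + 1 : ℕ) f U ↔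
      DifferentiableOn ℝ f U ∧ ∀ j, ContDiffOn ℝ n (coordPartial j f) U := by
  push_cast
  rw [contDiffOn_succ_iff_fderiv_of_isOpen hU]
  refine and_congr_right fun hd => ?_
  have hd' : ∀ x ∈ U, DifferentiableAt ℝ f x := fun x hx => hd.differentiableAt (hU.mem_nhds hx)
  simp only [WithTop.natCast_ne_top, false_imp_iff, true_and, contDiffOn_clm_apply]
  constructor
  · intro h j
    exact (h (EuclideanSpace.single j 1)).congr fun _ hx => (hd' _ hx).lineDeriv_eq_fderiv
  · intro h y
    refine ContDiffOn.congr (f := fun x => ∑ j, y j * coordPartial j f x) ?_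
      fun x hx => fderiv_apply_eq_sum (hd' x hx) y
    exact ContDiffOn.sum fun j _ => contDiffOn_const.mul (h j)

lemma coordPartial_eqOn (hU : IsOpen U) (h : EqOn f g U) (j : Fin d) :
    EqOn (coordPartial j f) (coordPartial j g) U := fun _ hx =>
  (h.eventuallyEq_of_mem (hU.mem_nhds hx)).lineDeriv_eq

lemma coordPartial_comm (hU : IsOpen U) (hf : ContDiffOn ℝ (2 : ℕ) f U) (i j : Fin d) :
    EqOn (coordPartial i (coordPartial j f)) (coordPartial j (coordPartial i f)) U := by
  have key : ∀ i j, EqOn (coordPartial i (coordPartial j f))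
      (fun x => fderiv ℝ (fderiv ℝ f) x (EuclideanSpace.single i 1)
        (EuclideanSpace.single j 1)) U := by
    intro i j x hx
    have hfx : ContDiffAt ℝ 2 f x := hf.contDiffAt (hU.mem_nhds hx)
    have h1 : EqOn (coordPartial j f) (fun x => fderiv ℝ f x (EuclideanSpace.single j 1)) U :=
      fun y hy => DifferentiableAt.lineDeriv_eq_fderiv
        ((hf.contDiffAt (hU.mem_nhds hy)).differentiableAt (by simp))
    have h2 : DifferentiableAt ℝ (fderiv ℝ f) x :=
      (hfx.fderiv_right (m := 1) (by norm_num)).differentiableAt (by simp)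
    rw [coordPartial_eqOn hU h1 i hx, coordPartial,
      DifferentiableAt.lineDeriv_eq_fderiv (h2.clm_apply (differentiableAt_const _)),
      fderiv_clm_apply h2 (differentiableAt_const _)]
    simp
  intro x hx
  have hfx : ContDiffAt ℝ 2 f x := hf.contDiffAt (hU.mem_nhds hx)
  rw [key i j hx, key j i hx]
  exact hfx.isSymmSndFDerivAt (by simp) _ _

lemma contDiffOn_listPartial (hU : IsOpen U) {k : ℕ} (l : List (Fin d))
    (hf : ContDiffOn ℝ (l.length + k : ℕ) f U) : ContDiffOn ℝ k (listPartial l f) U := by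
  induction l generalizing k with
  | nil => simpa [_root_.listPartial] using hf
  | cons a l ih =>
    refine ((contDiffOn_succ_iff_coordPartial hU).1 (ih (k := k + 1) ?_)).2 a
    rwa [List.length_cons, add_assoc, add_comm 1 k] at hf

/-- Adjacent swaps generate all permutations, and each is the symmetry of a second derivative. -/
lemma listPartial_eqOn_of_perm (hU : IsOpen U) {l l' : List (Fin d)} (h : l.Perm l')
    (hf : ContDiffOn ℝ l.length f U) : EqOn (listPartial l f) (listPartial l' f) U := by
  induction h with
  | nil => exact fun _ _ => rfl
  | cons a h ih => exact coordPartial_eqOn hU (ih (hf.of_le (by simp))) a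
  | swap a b l =>
    refine coordPartial_comm hU (contDiffOn_listPartial hU (k := 2) l ?_) b a
    exact hf
  | trans h₁ h₂ ih₁ ih₂ => exact (ih₁ hf).trans (ih₂ (by rwa [← h₁.length_eq]))

lemma HolderDiff.listPartial {k : ℕ} (l : List (Fin d)) (hf : HolderDiff α U (l.length + k) f) :
    HolderDiff α U k (listPartial l f) := by
  induction l generalizing k with
  | nil => simpa [_root_.listPartial] using hf
  | cons a l ih =>
    refine (ih (k := k + 1) ?_).2 a
    rwa [List.length_cons, add_assoc, add_comm 1 k] at hf

lemma HolderDiff.contDiffOn (hα : 0 < α) (hU : IsOpen U) {m : ℕ} (hf : HolderDiff α U m f) :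
    ContDiffOn ℝ m f U := by
  induction m generalizing f with
  | zero => simpa using LocHolderOn.continuousOn hα hU hf
  | succ m ih => exact (contDiffOn_succ_iff_coordPartial hU).2 ⟨hf.1, fun j => ih (hf.2 j)⟩

/-- Multiindices prescribe one order of differentiation, the recursion allows all. For `C^m`
functions a list of length `m` can be sorted into the multiindex of its counts. -/
lemma memHolderClassOn_iff (hα : 0 < α) (hU : IsOpen U) {m : ℕ} :
    MemHolderClassOn m α U f ↔ HolderDiff α U m f := by
  constructor
  · rintro ⟨hf, hγ⟩
    suffices ∀ (k : ℕ) (l : List (Fin d)), l.length + k = m →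
        HolderDiff α U k (listPartial l f) by simpa [listPartial] using this m [] (by simp)
    intro k
    induction k with
    | zero =>
      intro l hl
      have hlm : l.length = m := hl
      refine LocHolderOn.congr (hγ (fun j => l.count j) ?_) ?_
      · rw [← hlm]
        simpa using Multiset.sum_count_eq_card (s := Finset.univ) (m := (l : Multiset (Fin d)))
          (by simp)
      · rw [multiPartial_eq_listPartial]
        refine listPartial_eqOn_of_perm hU (List.perm_iff_count.2 fun a => ?_) (by rwa [hlm])
        rw [List.count_flatMap]
        simp [Function.comp_def, List.count_replicate, ← List.ofFn_eq_map, List.sum_ofFn]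
    | succ k ih =>
      intro l hl
      refine ⟨(contDiffOn_listPartial hU (k := k + 1) l (by rwa [hl])).differentiableOn (by simp),
        fun j => ih (j :: l) ?_⟩
      rw [List.length_cons]
      omega
  · intro hf
    refine ⟨hf.contDiffOn hα hU, fun γ hγ => ?_⟩
    rw [multiPartial_eq_listPartial]
    refine HolderDiff.listPartial (k := 0) _ ?_
    have : ((List.finRange d).flatMap fun j => List.replicate (γ j) j).length = m := by
      rw [← hγ]
      simp [List.length_flatMap, ← List.ofFn_eq_map, List.sum_ofFn]
    rwa [this]

lemma HolderDiff.comp_curve (hα : 0 < α) (hα₁ : α ≤ 1) (hU : IsOpen U) {m : ℕ}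
    (hf : HolderDiff α U m f) {c : ℝ → EuclideanSpace ℝ (Fin d)} (hc : ContDiff ℝ ∞ c)
    (hcU : ∀ t, c t ∈ U) : HolderDiffReal α m (f ∘ c) := by
  induction m generalizing f with
  | zero =>
    refine locHolderOn_of_forall_nhds hα fun t₀ _ => ?_
    obtain ⟨K, hK, hKU, hKc⟩ := local_compact_nhds (hU.mem_nhds (hcU t₀))
    obtain ⟨C, hC⟩ := hf K hKU hKc
    obtain ⟨L, V, hV, hL⟩ := (hc.of_le (m := 1) (by simp)).locallyLipschitz t₀
    refine ⟨V ∩ c ⁻¹' K, inter_mem hV (hc.continuous.continuousAt hK), max C 0 * L ^ α, ?_⟩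
    rintro s ⟨hs, hsK⟩ t ⟨ht, htK⟩
    calc |f (c t) - f (c s)| ≤ C * dist (c t) (c s) ^ α := hC _ hsK _ htK
      _ ≤ max C 0 * dist (c t) (c s) ^ α := by gcongr; exact le_max_left _ _
      _ ≤ max C 0 * (L * dist t s) ^ α := by
        gcongr
        exact hL.dist_le_mul t ht s hs
      _ = _ := by rw [Real.mul_rpow L.coe_nonneg dist_nonneg, mul_assoc]
  | succ m ih =>
    have hd : ∀ t, DifferentiableAt ℝ f (c t) := fun t => hf.1.differentiableAt (hU.mem_nhds (hcU t))
    have hcd : Differentiable ℝ c := hc.differentiable (by simp)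
    refine ⟨fun t => (hd t).comp t (hcd t), ?_⟩
    have : deriv (f ∘ c) = fun t => ∑ j, (coordPartial j f ∘ c) t * deriv c t j := by
      funext t
      have := ((hd t).hasFDerivAt.comp_hasDerivAt t (hcd t).hasDerivAt).deriv
      rw [this, fderiv_apply_eq_sum (hd t)]
      simp [mul_comm]
    rw [this]
    refine HolderDiffReal.sum _ fun j _ => (ih (hf.2 j)).mul_contDiff hα hα₁ ?_
    exact contDiff_euclidean.1 (contDiff_infty_iff_deriv.1 hc).2 j

end Partials

/-! ### Converse of Taylor's theorem -/

/-- `P` is recovered on every line from its values at the points with parameters `0, 1, …, N`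
by polynomial interpolation. -/
def InterpolatedOnLines {E : Type*} [AddCommGroup E] [Module ℝ E] (N : ℕ) (P : E → ℝ) : Prop :=
  ∀ (h v : E) (s : ℝ), P (h + s • v) =
    ∑ j ∈ Finset.range (N + 1), lagrangeWeight N j s * P (h + (j : ℝ) • v)

/-- Every `x ∈ U` has a polynomial `P x` approximating `h ↦ f (x + h)` up to
`O(‖h‖ ^ (m + α))`, locally uniformly in `x`. -/
def TaylorApprox {E : Type*} [NormedAddCommGroup E] [NormedSpace ℝ E] (N m : ℕ) (α : ℝ) (U : Set E)
    (f : E → ℝ) (P : E → E → ℝ) : Prop :=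
  (∀ x ∈ U, InterpolatedOnLines N (P x)) ∧ ∀ x₀ ∈ U, ∃ r > 0, ∃ C : ℝ, ∀ x ∈ Metric.ball x₀ r,
    ∀ h, ‖h‖ ≤ r → |f (x + h) - P x h| ≤ C * ‖h‖ ^ (m + α)

section

variable {d : ℕ} {N : ℕ} {P : EuclideanSpace ℝ (Fin d) → ℝ}

/-- Interpolating in one coordinate at a time writes `P` as a finite sum of products of weights in
the single coordinates with constants. -/
lemma InterpolatedOnLines.contDiff (hP : InterpolatedOnLines N P) {n : WithTop ℕ∞} :
    ContDiff ℝ n P := by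
  have key : ∀ (S : Finset (Fin d)) (w : EuclideanSpace ℝ (Fin d)),
      ContDiff ℝ n fun h : EuclideanSpace ℝ (Fin d) =>
        P (w + ∑ i ∈ S, h i • EuclideanSpace.single i (1 : ℝ)) := by
    intro S
    induction S using Finset.induction_on with
    | empty => intro w; simpa using contDiff_const
    | insert a S ha ih =>
      intro w
      have e : (fun h : EuclideanSpace ℝ (Fin d) =>
          P (w + ∑ i ∈ insert a S, h i • EuclideanSpace.single i (1 : ℝ))) =
          fun h => ∑ j ∈ Finset.range (N + 1), lagrangeWeight N j (h a) *
            P (w + (j : ℝ) • EuclideanSpace.single a (1 : ℝ) +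
              ∑ i ∈ S, h i • EuclideanSpace.single i (1 : ℝ)) := by
        funext h
        rw [Finset.sum_insert ha, add_comm (h a • _), ← add_assoc, hP]
        simp only [add_right_comm]
      rw [e]
      refine ContDiff.sum fun j _ => ContDiff.mul ?_ (ih _)
      exact (contDiff_lagrangeWeight N j).comp (contDiff_euclidean.1 contDiff_id a)
  have := key Finset.univ 0
  simpa [EuclideanSpace.sum_smul_single] using this

/-- Bounds on values of `P` thus become bounds on its derivatives. -/
lemma InterpolatedOnLines.lineDeriv_eq (hP : InterpolatedOnLines N P)
    (h v : EuclideanSpace ℝ (Fin d)) :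
    lineDeriv ℝ P h v =
      ∑ j ∈ Finset.range (N + 1), deriv (lagrangeWeight N j) 0 * P (h + (j : ℝ) • v) := by
  rw [lineDeriv, funext fun s => hP h v s]
  rw [deriv_fun_sum fun j _ =>
    (((contDiff_lagrangeWeight N j (n := 1)).differentiable (by simp)).mul_const _) 0]
  exact Finset.sum_congr rfl fun j _ => deriv_mul_const
    ((contDiff_lagrangeWeight N j (n := 1)).differentiable (by simp) 0) _

lemma InterpolatedOnLines.lineDeriv (hP : InterpolatedOnLines N P)
    (v : EuclideanSpace ℝ (Fin d)) : InterpolatedOnLines N fun h => lineDeriv ℝ P h v := by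
  intro h w s
  simp only [hP.lineDeriv_eq, Finset.mul_sum]
  rw [Finset.sum_comm]
  refine Finset.sum_congr rfl fun j _ => ?_
  rw [add_right_comm, hP, Finset.mul_sum]
  refine Finset.sum_congr rfl fun i _ => ?_
  rw [add_right_comm]
  ring

variable {m : ℕ} {α : ℝ} {U : Set (EuclideanSpace ℝ (Fin d))} {f : EuclideanSpace ℝ (Fin d) → ℝ}
  {P : EuclideanSpace ℝ (Fin d) → EuclideanSpace ℝ (Fin d) → ℝ}

lemma TaylorApprox.apply_zero (hα : 0 < α) (hP : TaylorApprox N m α U f P)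
    {x : EuclideanSpace ℝ (Fin d)} (hx : x ∈ U) : P x 0 = f x := by
  obtain ⟨r, hr, C, hC⟩ := hP.2 x hx
  have := hC x (Metric.mem_ball_self hr) 0 (by simpa using hr.le)
  have h0 : (m : ℝ) + α ≠ 0 := by positivity
  rw [norm_zero, Real.zero_rpow h0, mul_zero, add_zero, abs_nonpos_iff] at this
  linarith

lemma TaylorApprox.bounded_nhds (hα : 0 < α) (hP : TaylorApprox N m α U f P)
    {x₀ : EuclideanSpace ℝ (Fin d)} (hx₀ : x₀ ∈ U) :
    ∃ r > 0, ∃ M : ℝ, ∀ x ∈ Metric.ball x₀ r, |f x| ≤ M := by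
  obtain ⟨r, hr, C, hC⟩ := hP.2 x₀ hx₀
  obtain ⟨M, hM⟩ := (isCompact_closedBall (0 : EuclideanSpace ℝ (Fin d)) r).exists_bound_of_continuousOn
    (((hP.1 x₀ hx₀).contDiff (n := 0)).continuous.continuousOn)
  refine ⟨r, hr, |C| * r ^ (m + α) + M, fun x hx => ?_⟩
  have hn : ‖x - x₀‖ ≤ r := (mem_ball_iff_norm.1 hx).le
  have h1 := hC x₀ (Metric.mem_ball_self hr) (x - x₀) hn
  have h2 := hM (x - x₀) (by simpa using hn)
  rw [add_sub_cancel] at h1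
  rw [Real.norm_eq_abs] at h2
  have h3 : C * ‖x - x₀‖ ^ (m + α) ≤ |C| * r ^ (m + α) := by
    gcongr
    exact le_abs_self C
  have := abs_sub_abs_le_abs_sub (f x) (P x₀ (x - x₀))
  linarith

/-- `P x` need not be constant, since `N` may exceed `m = 0`. But its node values are bounded
uniformly in `x`, so it is uniformly Lipschitz at `0`, and `α ≤ 1` absorbs this. -/
lemma TaylorApprox.locHolderOn (hα : 0 < α) (hα₁ : α ≤ 1) (hU : IsOpen U)
    (hP : TaylorApprox N 0 α U f P) : LocHolderOn α U f := by
  refine locHolderOn_of_forall_nhds hα fun x₀ hx₀ => ?_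
  obtain ⟨r₁, hr₁, C, hC⟩ := hP.2 x₀ hx₀
  obtain ⟨r₂, hr₂, M, hM⟩ := hP.bounded_nhds hα hx₀
  obtain ⟨r₃, hr₃, hrU⟩ := Metric.isOpen_iff.1 hU x₀ hx₀
  simp only [CharP.cast_eq_zero, zero_add] at hC
  set C' := max C 0 with hC'
  have hCC : 0 ≤ C' := le_max_right _ _
  have hM0 : 0 ≤ M := (abs_nonneg _).trans (hM x₀ (Metric.mem_ball_self hr₂))
  obtain ⟨r, hr, hr1, hr2, hr3⟩ : ∃ r > 0, r ≤ r₁ ∧ r ≤ r₂ / 2 ∧ r ≤ r₃ :=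
    ⟨min r₁ (min (r₂ / 2) r₃), by positivity, min_le_left _ _,
      (min_le_right _ _).trans (min_le_left _ _), (min_le_right _ _).trans (min_le_right _ _)⟩
  have hlip : ∀ j : ℕ, ∃ A : ℝ, 0 ≤ A ∧ ∀ τ ∈ Icc (0 : ℝ) 1,
      |lagrangeWeight N j τ - lagrangeWeight N j 0| ≤ A * τ := by
    intro j
    obtain ⟨K, hK⟩ := (contDiff_lagrangeWeight N j (n := 1)).contDiffOn.exists_lipschitzOnWith
      (s := Icc (0 : ℝ) 1) (by simp) (convex_Icc 0 1) isCompact_Icc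
    refine ⟨K, K.2, fun τ hτ => ?_⟩
    have := hK.dist_le_mul τ hτ 0 (by simp)
    simpa [Real.dist_eq, abs_of_nonneg hτ.1] using this
  choose A hA0 hA using hlip
  -- Nodes `j • w` with `j ≤ N` and `‖w‖ = ρ` have norm at most `r`; `ρ ≤ 1` serves `dist ≤ dist ^
  -- α`.
  set ρ := min (r / (N + 1)) (1 : ℝ) with hρ
  have hρ0 : 0 < ρ := by positivity
  have hρ1 : ρ ≤ 1 := min_le_right _ _
  have hρr : ∀ j ∈ Finset.range (N + 1), (j : ℝ) * ρ ≤ r := by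
    intro j hj
    have hj : (j : ℝ) ≤ N + 1 := by exact_mod_cast (Finset.mem_range.1 hj).le
    calc (j : ℝ) * ρ ≤ (N + 1) * (r / (N + 1)) := by gcongr; exact min_le_left _ _
      _ = r := by field_simp
  set B := ∑ j ∈ Finset.range (N + 1), A j * (M + C' * r ^ α) with hB
  have hB0 : 0 ≤ B := Finset.sum_nonneg fun j _ => mul_nonneg (hA0 j) (by positivity)
  have hpoly : ∀ x ∈ Metric.ball x₀ r, ∀ h, ‖h‖ ≤ ρ → |P x h - P x 0| ≤ B / ρ * ‖h‖ := by
    intro x hx h hh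
    rcases eq_or_ne h 0 with rfl | h0
    · simp
    have hn : 0 < ‖h‖ := norm_pos_iff.2 h0
    -- Interpolation along a vector of fixed length `ρ`, with `h` at parameter `τ ≤ 1`, gives bounds
    -- linear in `‖h‖`.
    set w := (ρ / ‖h‖) • h with hw
    have hwn : ‖w‖ = ρ := by
      rw [hw, norm_smul, Real.norm_of_nonneg (by positivity)]
      field_simp
    set τ := ‖h‖ / ρ with hτ
    have hτ1 : τ ∈ Icc (0 : ℝ) 1 := ⟨by positivity, (div_le_one hρ0).2 hh⟩
    have hhw : h = (0 : EuclideanSpace ℝ (Fin d)) + τ • w := by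
      rw [hw, hτ, smul_smul, zero_add]
      field_simp
      simp
    have h1 := (hP.1 x (hrU (Metric.ball_subset_ball hr3 hx))) 0 w
    have hb : ∀ j ∈ Finset.range (N + 1), |P x (0 + (j : ℝ) • w)| ≤ M + C' * r ^ α := by
      intro j hj
      have hjn : ‖(j : ℝ) • w‖ ≤ r := by
        rw [norm_smul, hwn, Real.norm_natCast]
        exact hρr j hj
      have e1 := hC x (Metric.ball_subset_ball hr1 hx) ((j : ℝ) • w) (hjn.trans hr1)
      have e2 : |f (x + (j : ℝ) • w)| ≤ M := by
        refine hM _ ?_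
        rw [mem_ball_iff_norm] at hx ⊢
        calc ‖x + (j : ℝ) • w - x₀‖ = ‖(x - x₀) + (j : ℝ) • w‖ := by congr 1; abel
          _ ≤ ‖x - x₀‖ + ‖(j : ℝ) • w‖ := norm_add_le _ _
          _ < r₂ := by linarith
      have e3 : C * ‖(j : ℝ) • w‖ ^ α ≤ C' * r ^ α := by
        gcongr
        exact le_max_left _ _
      have e4 := abs_sub_abs_le_abs_sub (P x ((j : ℝ) • w)) (f (x + (j : ℝ) • w))
      rw [abs_sub_comm] at e4
      rw [zero_add]
      linarith
    have h2 : P x h - P x 0 = ∑ j ∈ Finset.range (N + 1),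
        (lagrangeWeight N j τ - lagrangeWeight N j 0) * P x (0 + (j : ℝ) • w) := by
      have h10 := h1 0
      rw [zero_smul, add_zero] at h10
      conv_lhs => rw [hhw, h1 τ, h10]
      rw [← Finset.sum_sub_distrib]
      simp only [sub_mul]
    rw [h2]
    calc _ ≤ ∑ j ∈ Finset.range (N + 1), A j * τ * (M + C' * r ^ α) := by
          refine (Finset.abs_sum_le_sum_abs _ _).trans (Finset.sum_le_sum fun j hj => ?_)
          rw [abs_mul]
          exact mul_le_mul (hA j τ hτ1) (hb j hj) (abs_nonneg _) (mul_nonneg (hA0 j) hτ1.1)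
      _ = B * τ := by
          rw [hB, Finset.sum_mul]
          exact Finset.sum_congr rfl fun j _ => by ring
      _ = _ := by rw [hτ]; ring
  refine ⟨Metric.ball x₀ (ρ / 2) ∩ Metric.ball x₀ r, inter_mem (Metric.ball_mem_nhds _ (by positivity))
    (Metric.ball_mem_nhds _ hr), C' + B / ρ, ?_⟩
  rintro x ⟨hx, hxr⟩ y ⟨hy, -⟩
  have hd : dist y x ≤ ρ := by
    have := dist_triangle_right y x x₀
    rw [Metric.mem_ball] at hx hy
    linarith
  have hnd : ‖y - x‖ = dist y x := (dist_eq_norm y x).symm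
  have hρr' : ρ ≤ r := (min_le_left _ _).trans
    (div_le_self hr.le (by linarith [(Nat.cast_nonneg N : (0 : ℝ) ≤ N)]))
  have e1 := hC x (Metric.ball_subset_ball hr1 hxr) (y - x) (by rw [hnd]; linarith)
  have e2 := hpoly x hxr (y - x) (by rwa [hnd])
  rw [hP.apply_zero hα (hrU (Metric.ball_subset_ball hr3 hxr))] at e2
  rw [add_sub_cancel, hnd] at e1
  rw [hnd] at e2
  have e3 : dist y x ≤ dist y x ^ α := by
    rcases (dist_nonneg (x := y) (y := x)).eq_or_lt with h0 | h0
    · rw [← h0]; positivity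
    · calc dist y x = dist y x ^ (1 : ℝ) := (Real.rpow_one _).symm
        _ ≤ _ := Real.rpow_le_rpow_of_exponent_ge h0 (hd.trans hρ1) hα₁
  have e4 : C * dist y x ^ α ≤ C' * dist y x ^ α := by gcongr; exact le_max_left _ _
  have e5 : B / ρ * dist y x ≤ B / ρ * dist y x ^ α := by gcongr
  have := abs_add_le (f y - P x (y - x)) (P x (y - x) - f x)
  rw [sub_add_sub_cancel] at this
  linarith

lemma TaylorApprox.hasFDerivAt (hα : 0 < α) (hP : TaylorApprox N (m + 1) α U f P)
    {x : EuclideanSpace ℝ (Fin d)} (hx : x ∈ U) : HasFDerivAt f (fderiv ℝ (P x) 0) x := by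
  obtain ⟨r, hr, C, hC⟩ := hP.2 x hx
  have h1 : HasFDerivAt (P x) (fderiv ℝ (P x) 0) 0 :=
    (((hP.1 x hx).contDiff (n := 1)).differentiable (by simp) 0).hasFDerivAt
  rw [hasFDerivAt_iff_isLittleO_nhds_zero] at h1 ⊢
  have h2 : (fun h => f (x + h) - P x h) =o[𝓝 0] fun h => h := by
    rw [Asymptotics.isLittleO_iff]
    intro c hc
    have ht : Tendsto (fun h : EuclideanSpace ℝ (Fin d) => |C| * ‖h‖ ^ (m + α)) (𝓝 0) (𝓝 0) := by
      have h1 := (tendsto_norm_zero (E := EuclideanSpace ℝ (Fin d))).rpow_const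
        (p := m + α) (Or.inr (by positivity))
      have h0 : (m : ℝ) + α ≠ 0 := by positivity
      simpa [Real.zero_rpow h0] using h1.const_mul |C|
    filter_upwards [ht.eventually (gt_mem_nhds hc), Metric.closedBall_mem_nhds _ hr] with h h1 h2
    have h3 := hC x (Metric.mem_ball_self hr) h (by simpa using h2)
    have e : ‖h‖ ^ ((m + 1 : ℕ) + α) = ‖h‖ ^ (m + α) * ‖h‖ := by
      rw [← Real.rpow_add_one' (norm_nonneg _) (by positivity)]
      push_cast
      ring_nf
    rw [e] at h3
    rw [Real.norm_eq_abs]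
    refine h3.trans ?_
    rw [← mul_assoc]
    gcongr
    refine le_trans ?_ h1.le
    gcongr
    exact le_abs_self C
  refine (h2.add h1).congr_left fun h => ?_
  rw [hP.apply_zero hα hx, zero_add]
  ring

lemma TaylorApprox.coordPartial_eq (hα : 0 < α) (hP : TaylorApprox N (m + 1) α U f P) (j : Fin d)
    {x : EuclideanSpace ℝ (Fin d)} (hx : x ∈ U) :
    coordPartial j f x = lineDeriv ℝ (P x) 0 (EuclideanSpace.single j 1) := by
  rw [coordPartial, ((hP.hasFDerivAt hα hx).hasLineDerivAt _).lineDeriv,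
    (((hP.1 x hx).contDiff (n := 1)).differentiable (by simp) 0).lineDeriv_eq_fderiv]

/-- `P (x + h) k` and `P x (h + k)` both approximate `f (x + h + k)`, so for `k` of size `‖h‖` they
differ by `O(‖h‖ ^ (m + 1 + α))`. Differentiating in `k` at `0` costs one factor `‖h‖`. -/
lemma TaylorApprox.coordPartial (hα : 0 < α) (hU : IsOpen U)
    (hP : TaylorApprox N (m + 1) α U f P) (j : Fin d) :
    TaylorApprox N m α U (coordPartial j f)
      fun x h => lineDeriv ℝ (P x) h (EuclideanSpace.single j 1) := by
  refine ⟨fun x hx => (hP.1 x hx).lineDeriv _, fun x₀ hx₀ => ?_⟩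
  obtain ⟨r₁, hr₁, C, hC⟩ := hP.2 x₀ hx₀
  obtain ⟨r₂, hr₂, hrU⟩ := Metric.isOpen_iff.1 hU x₀ hx₀
  set C' := max C 0 with hC'
  have hCC : 0 ≤ C' := le_max_right _ _
  set r := min (r₁ / (N + 2)) (r₂ / 2) with hrd
  have hr : 0 < r := by positivity
  have hr2 : r ≤ r₂ / 2 := min_le_right _ _
  have hr1 : (N + 2) * r ≤ r₁ := by
    calc (N + 2) * r ≤ (N + 2) * (r₁ / (N + 2)) := by gcongr; exact min_le_left _ _
      _ = r₁ := by field_simp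
  have hN : (0 : ℝ) ≤ N := Nat.cast_nonneg N
  set e := EuclideanSpace.single j (1 : ℝ) with he
  have hen : ‖e‖ = 1 := by simp [he]
  refine ⟨r, hr, ∑ i ∈ Finset.range (N + 1),
    |deriv (lagrangeWeight N i) 0| * (2 * C' * (N + 2) ^ ((m + 1 : ℕ) + α)), fun x hx h hh => ?_⟩
  have hxU : x ∈ U := hrU (Metric.ball_subset_ball (by linarith) hx)
  have hxh : x + h ∈ Metric.ball x₀ (2 * r) := by
    rw [mem_ball_iff_norm] at hx ⊢
    calc ‖x + h - x₀‖ = ‖(x - x₀) + h‖ := by congr 1; abel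
      _ ≤ ‖x - x₀‖ + ‖h‖ := norm_add_le _ _
      _ < 2 * r := by linarith
  have hxhU : x + h ∈ U := hrU (Metric.ball_subset_ball (by linarith) hxh)
  rw [hP.coordPartial_eq hα j hxhU]
  rcases eq_or_ne h 0 with rfl | h0
  · rw [add_zero, sub_self, abs_zero]
    exact mul_nonneg (Finset.sum_nonneg fun i _ => by positivity) (by positivity)
  have hn : 0 < ‖h‖ := norm_pos_iff.2 h0
  -- Interpolating along `‖h‖ • e` puts the nodes at scale `‖h‖` and produces the factor `‖h‖⁻¹`.
  have hscale : ∀ y ∈ U, ∀ k, lineDeriv ℝ (P y) k e = ‖h‖⁻¹ * ∑ i ∈ Finset.range (N + 1),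
      deriv (lagrangeWeight N i) 0 * P y (k + (i : ℝ) • ‖h‖ • e) := by
    intro y hy k
    rw [← (hP.1 y hy).lineDeriv_eq, lineDeriv_smul, smul_eq_mul, inv_mul_cancel_left₀ hn.ne']
  beta_reduce
  rw [hscale _ hxhU, hscale _ hxU, ← mul_sub, ← Finset.sum_sub_distrib, abs_mul, abs_inv,
    abs_norm]
  have hbound : ∀ i ∈ Finset.range (N + 1),
      |P (x + h) (0 + (i : ℝ) • ‖h‖ • e) - P x (h + (i : ℝ) • ‖h‖ • e)| ≤
        2 * C' * (N + 2) ^ ((m + 1 : ℕ) + α) * ‖h‖ ^ ((m + 1 : ℕ) + α) := by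
    intro i hi
    have hi : (i : ℝ) ≤ N := by exact_mod_cast Nat.lt_succ_iff.1 (Finset.mem_range.1 hi)
    set k := (i : ℝ) • ‖h‖ • e with hk
    have hkn : ‖k‖ ≤ N * ‖h‖ := by
      rw [hk, norm_smul, norm_smul, hen, norm_norm, Real.norm_natCast, mul_one]
      gcongr
    have hk1 : ‖k‖ ≤ (N + 2) * ‖h‖ := by nlinarith
    have hk2 : ‖h + k‖ ≤ (N + 2) * ‖h‖ := by
      have := norm_add_le h k
      nlinarith
    have hh1 : (N + 2) * ‖h‖ ≤ r₁ := le_trans (by gcongr) hr1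
    have hcmp : ∀ z : EuclideanSpace ℝ (Fin d), ‖z‖ ≤ (N + 2) * ‖h‖ →
        C * ‖z‖ ^ ((m + 1 : ℕ) + α) ≤
          C' * ((N + 2) ^ ((m + 1 : ℕ) + α) * ‖h‖ ^ ((m + 1 : ℕ) + α)) := by
      intro z hz
      rw [← Real.mul_rpow (by positivity) hn.le]
      gcongr
      exact le_max_left _ _
    have e1 := (hC (x + h) (Metric.ball_subset_ball (by nlinarith) hxh) k (hk1.trans hh1)).trans
      (hcmp k hk1)
    have e2 := (hC x (Metric.ball_subset_ball (by nlinarith) hx) (h + k) (hk2.trans hh1)).trans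
      (hcmp _ hk2)
    rw [← add_assoc] at e2
    rw [zero_add]
    have := abs_sub_le (P (x + h) k) (f (x + h + k)) (P x (h + k))
    rw [abs_sub_comm (P (x + h) k) (f _)] at this
    linarith
  have e : ‖h‖ ^ ((m + 1 : ℕ) + α) = ‖h‖ ^ (m + α) * ‖h‖ := by
    rw [← Real.rpow_add_one' hn.le (by positivity)]
    push_cast
    ring_nf
  calc _ ≤ ‖h‖⁻¹ * ∑ i ∈ Finset.range (N + 1), |deriv (lagrangeWeight N i) 0| *
        (2 * C' * (N + 2) ^ ((m + 1 : ℕ) + α) * ‖h‖ ^ ((m + 1 : ℕ) + α)) := by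
        gcongr
        refine (Finset.abs_sum_le_sum_abs _ _).trans (Finset.sum_le_sum fun i hi => ?_)
        rw [← mul_sub, abs_mul]
        gcongr
        exact hbound i hi
    _ = _ := by
        rw [e, Finset.mul_sum, Finset.sum_mul]
        refine Finset.sum_congr rfl fun i _ => ?_
        field_simp

lemma TaylorApprox.holderDiff (hα : 0 < α) (hα₁ : α ≤ 1) (hU : IsOpen U)
    (hP : TaylorApprox N m α U f P) : HolderDiff α U m f := by
  induction m generalizing f P with
  | zero => exact hP.locHolderOn hα hα₁ hU
  | succ m ih =>
    exact ⟨fun x hx => (hP.hasFDerivAt hα hx).differentiableAt.differentiableWithinAt,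
      fun j => ih (hP.coordPartial hα hU j)⟩

end

/-! ### A smooth curve through prescribed segments -/

section SpecialCurve

variable {E : Type*} [NormedAddCommGroup E] [NormedSpace ℝ E]

/-- The sum of shrinking copies of a bump `ψ`, centred at `2⁻ⁿ` with width of order `2⁻ⁿ` and with
rapidly decreasing amplitudes `1 / n!` in the directions `w n`. -/
noncomputable def bumpSeries (ψ : ℝ → ℝ) (w : ℕ → E) (t : ℝ) : E :=
  ∑' n : ℕ, ((n.factorial : ℝ)⁻¹ * ψ (8 * 2 ^ n * (t - (2 ^ n)⁻¹))) • w n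

lemma exists_bound_iteratedDeriv {ψ : ℝ → ℝ} (hψ : ContDiff ℝ ∞ ψ) (hc : HasCompactSupport ψ)
    (k : ℕ) : ∃ M : ℝ, 0 ≤ M ∧ ∀ t, ‖iteratedDeriv k ψ t‖ ≤ M := by
  have h : HasCompactSupport (iteratedFDeriv ℝ k ψ) := hc.iteratedFDeriv k
  obtain ⟨M, hM⟩ := h.exists_bound_of_continuous (hψ.continuous_iteratedFDeriv
    (by exact_mod_cast le_top))
  exact ⟨M, (norm_nonneg _).trans (hM 0), fun t => by
    rw [← norm_iteratedFDeriv_eq_norm_iteratedDeriv]; exact hM t⟩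

/-- The `k`-th derivative of the `n`-th term is `O((2 ^ k) ^ n / n!)` for fixed `k`, which is
summable. -/
lemma contDiff_bumpSeries [CompleteSpace E] {ψ : ℝ → ℝ} (hψ : ContDiff ℝ ∞ ψ)
    (hc : HasCompactSupport ψ)
    {w : ℕ → E} (hw : ∀ n, ‖w n‖ ≤ 1) : ContDiff ℝ ∞ (bumpSeries ψ w) := by
  choose M hM0 hM using exists_bound_iteratedDeriv hψ hc
  refine contDiff_tsum (v := fun k n => M k * 8 ^ k * ((2 ^ k) ^ n / (n.factorial : ℝ))) ?_ ?_ ?_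
  · intro n
    exact (contDiff_const.mul (hψ.comp (by fun_prop))).smul contDiff_const
  · intro k _
    exact (Real.summable_pow_div_factorial _).mul_left _
  · intro k n t _
    have hsm : ContDiff ℝ ∞ fun t : ℝ => ψ (8 * 2 ^ n * (t - (2 ^ n)⁻¹)) := hψ.comp (by fun_prop)
    have hd : iteratedDeriv k (fun t : ℝ => ψ (8 * 2 ^ n * (t - (2 ^ n)⁻¹))) t =
        (8 * 2 ^ n) ^ k * iteratedDeriv k ψ (8 * 2 ^ n * (t - (2 ^ n)⁻¹)) := by
      rw [iteratedDeriv_comp_sub_const (f := fun z : ℝ => ψ (8 * 2 ^ n * z)),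
        iteratedDeriv_comp_const_mul (hψ.of_le (by exact_mod_cast le_top))]
    rw [norm_iteratedFDeriv_eq_norm_iteratedDeriv,
      iteratedDeriv_smul_const (contDiff_const.mul (hsm.of_le (by exact_mod_cast le_top))).contDiffAt,
      iteratedDeriv_const_mul_field, hd, norm_smul, norm_mul, norm_mul, norm_inv, Real.norm_natCast,
      norm_pow, norm_mul, norm_pow, Real.norm_ofNat, Real.norm_ofNat]
    calc _ ≤ ((n.factorial : ℝ)⁻¹ * ((8 * 2 ^ n) ^ k * M k)) * 1 := by
          gcongr
          · have := hM0 k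
            positivity
          · exact hM _ _
          · exact hw n
      _ = _ := by
          rw [mul_pow, ← pow_mul, ← pow_mul, mul_comm n k]
          field_simp

lemma norm_bumpSeries_le {ψ : ℝ → ℝ} {M : ℝ} (hM : ∀ t, |ψ t| ≤ M)
    {w : ℕ → E} (hw : ∀ n, ‖w n‖ ≤ 1) (t : ℝ) : ‖bumpSeries ψ w t‖ ≤ M * Real.exp 1 := by
  have hs : HasSum (fun n : ℕ => M * ((1 : ℝ) ^ n / n.factorial)) (M * Real.exp 1) := by
    have := NormedSpace.expSeries_div_hasSum_exp (1 : ℝ)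
    rw [← Real.exp_eq_exp_ℝ] at this
    exact this.mul_left M
  refine tsum_of_norm_bounded hs fun n => ?_
  rw [norm_smul, norm_mul, norm_inv, Real.norm_natCast, one_pow, Real.norm_eq_abs]
  calc _ ≤ ((n.factorial : ℝ)⁻¹ * M) * 1 := by
        gcongr
        · have := (abs_nonneg _).trans (hM 0)
          positivity
        · exact hM _
        · exact hw n
    _ = _ := by ring

/-- The `k`-th bump vanishes at distance `2⁻ᵏ / 4` or more from `2⁻ᵏ`, and the points considered are
at least that far away when `k ≠ n`. -/
lemma bumpSeries_apply {ψ : ℝ → ℝ} (hψ : ∀ τ, 2 ≤ |τ| → ψ τ = 0) (w : ℕ → E) {n : ℕ} {s : ℝ}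
    (hs : s ∈ Icc 0 (8 * 2 ^ n : ℝ)⁻¹) :
    bumpSeries ψ w ((2 ^ n)⁻¹ + s) = ((n.factorial : ℝ)⁻¹ * ψ (8 * 2 ^ n * s)) • w n := by
  rw [bumpSeries, tsum_eq_single n, add_sub_cancel_left]
  intro k hk
  rw [hψ, mul_zero, zero_smul]
  rw [abs_mul, abs_of_pos (by positivity : (0 : ℝ) < 8 * 2 ^ k)]
  have hs' : s ≤ (2 ^ n : ℝ)⁻¹ / 8 := by
    refine hs.2.trans (le_of_eq ?_)
    rw [mul_inv]; ring
  suffices (2 ^ k : ℝ)⁻¹ / 4 ≤ |(2 ^ n : ℝ)⁻¹ + s - (2 ^ k)⁻¹| by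
    calc (2 : ℝ) = 8 * 2 ^ k * ((2 ^ k : ℝ)⁻¹ / 4) := by field_simp; norm_num
      _ ≤ _ := by gcongr
  have hhalf : ∀ {i j : ℕ}, i < j → (2 ^ j : ℝ)⁻¹ ≤ (2 ^ i : ℝ)⁻¹ / 2 := by
    intro i j hij
    rw [div_eq_mul_inv, ← mul_inv, ← pow_succ]
    exact inv_anti₀ (by positivity) (pow_le_pow_right₀ (by norm_num) hij)
  have hk0 : (0 : ℝ) < (2 ^ k : ℝ)⁻¹ := by positivity
  rcases lt_or_gt_of_ne hk with h | h
  · have := hhalf h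
    rw [abs_sub_comm]
    refine le_trans ?_ (le_abs_self _)
    linarith
  · have := hhalf h
    refine le_trans ?_ (le_abs_self _)
    linarith [hs.1]

/-- There is a smooth curve, within a distance of the base point that depends only on `ε`, which
runs through prescribed short line segments with rapidly decreasing data. -/
lemma exists_smooth_curve_through_segments (E : Type*) [NormedAddCommGroup E] [NormedSpace ℝ E]
    [CompleteSpace E] :
    ∃ B : ℝ, 0 < B ∧ ∀ (x₀ : E) (ε : ℝ), 0 < ε → ∀ y u : ℕ → E, (∀ n, ‖y n‖ ≤ 1) →
      (∀ n, ‖u n‖ ≤ 1) → ∃ c : ℝ → E, ContDiff ℝ ∞ c ∧ (∀ t, ‖c t - x₀‖ ≤ B * ε) ∧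
        ∀ n : ℕ, ∀ s ∈ Icc 0 (8 * 2 ^ n : ℝ)⁻¹,
          c ((2 ^ n)⁻¹ + s) = x₀ + (ε * (n.factorial : ℝ)⁻¹) • (y n + s • u n) := by
  let φ : ContDiffBump (0 : ℝ) := ⟨1, 2, one_pos, one_lt_two⟩
  have hφ0 : ∀ τ, 2 ≤ |τ| → φ τ = 0 := fun τ hτ => φ.zero_of_le_dist (by simpa using hτ)
  have hφ1 : ∀ τ, |τ| ≤ 1 → φ τ = 1 := fun τ hτ =>
    φ.one_of_mem_closedBall (by simpa [Real.dist_eq] using hτ)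
  have hφa : ∀ τ, |φ τ| ≤ 1 := fun τ => by
    rw [abs_of_nonneg φ.nonneg]; exact φ.le_one
  have hψa : ∀ τ, |τ * φ τ| ≤ 2 := by
    intro τ
    rcases le_total 2 |τ| with h | h
    · simp [hφ0 τ h]
    · rw [abs_mul]
      calc |τ| * |φ τ| ≤ 2 * 1 := mul_le_mul h (hφa τ) (abs_nonneg _) (by norm_num)
        _ = 2 := by norm_num
  have hφs : ContDiff ℝ ∞ φ := φ.contDiff
  refine ⟨1 * Real.exp 1 + 2 * Real.exp 1, by positivity, fun x₀ ε hε y u hy hu => ?_⟩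
  have hu' : ∀ n : ℕ, ‖(8 * 2 ^ n : ℝ)⁻¹ • u n‖ ≤ 1 := by
    intro n
    rw [norm_smul, norm_inv, Real.norm_of_nonneg (by positivity)]
    refine mul_le_one₀ (inv_le_one_of_one_le₀ ?_) (norm_nonneg _) (hu n)
    have : (1 : ℝ) ≤ 2 ^ n := one_le_pow₀ (by norm_num)
    linarith
  -- On `[-1, 1]` the profiles `φ τ` and `τ * φ τ` equal `1` and `τ`; scaling `u n` by `(8 * 2 ^
  -- n)⁻¹` turns `τ = 8 * 2 ^ n * s` back into `s`.
  set w : ℕ → E := fun n => (8 * 2 ^ n : ℝ)⁻¹ • u n with hw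
  refine ⟨fun t => x₀ + ε • (bumpSeries φ y t + bumpSeries (fun τ => τ * φ τ) w t), ?_, ?_, ?_⟩
  · refine contDiff_const.add (contDiff_const.smul (ContDiff.add ?_ ?_))
    · exact contDiff_bumpSeries hφs φ.hasCompactSupport hy
    · exact contDiff_bumpSeries (contDiff_id.mul hφs) φ.hasCompactSupport.mul_left hu'
  · intro t
    rw [add_sub_cancel_left, norm_smul, Real.norm_of_nonneg hε.le, mul_comm]
    gcongr
    exact (norm_add_le _ _).trans
      (add_le_add (norm_bumpSeries_le hφa hy t) (norm_bumpSeries_le hψa hu' t))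
  · intro n s hs
    have h1 : |8 * 2 ^ n * s| ≤ 1 := by
      rw [abs_of_nonneg (mul_nonneg (by positivity) hs.1)]
      calc 8 * 2 ^ n * s ≤ 8 * 2 ^ n * (8 * 2 ^ n : ℝ)⁻¹ := by gcongr; exact hs.2
        _ = 1 := mul_inv_cancel₀ (by positivity)
    beta_reduce
    rw [bumpSeries_apply hφ0 y hs, bumpSeries_apply (fun τ hτ => by simp [hφ0 τ hτ]) w hs, hφ1 _ h1,
      hw, mul_smul ε, smul_add _ (y n)]
    simp only [mul_one, smul_smul]
    congr 4
    field_simp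

end SpecialCurve

/-! ### Taylor estimates in one variable -/

lemma isLittleO_pow_of_eventually_le_rpow {α : ℝ} (hα : 0 < α) {m : ℕ} {C : ℝ} {F : ℝ → ℝ}
    (h : ∀ᶠ s in 𝓝[≥] (0 : ℝ), |F s| ≤ C * s ^ (m + α)) :
    F =o[𝓝[≥] (0 : ℝ)] fun s => s ^ m := by
  rw [Asymptotics.isLittleO_iff]
  intro c hc
  have ht : Tendsto (fun s : ℝ => |C| * s ^ α) (𝓝[≥] 0) (𝓝 0) := by
    have h1 : Tendsto (fun s : ℝ => s) (𝓝[≥] 0) (𝓝 0) := tendsto_id.mono_left nhdsWithin_le_nhds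
    have h2 := (h1.rpow_const (p := α) (Or.inr hα.le)).const_mul |C|
    simpa [Real.zero_rpow hα.ne'] using h2
  filter_upwards [h, ht.eventually (gt_mem_nhds hc), self_mem_nhdsWithin] with s h1 h2 hs
  have hs : 0 ≤ s := hs
  rw [Real.norm_eq_abs, Real.norm_of_nonneg (by positivity)]
  rw [Real.rpow_add_of_nonneg hs (Nat.cast_nonneg m) hα.le, Real.rpow_natCast] at h1
  calc |F s| ≤ C * (s ^ m * s ^ α) := h1
    _ ≤ |C| * (s ^ m * s ^ α) := by gcongr; exact le_abs_self C
    _ = (|C| * s ^ α) * s ^ m := by ring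
    _ ≤ c * s ^ m := by gcongr

/-- The Lagrange remainder of order `m`, minus the top Taylor term, is `(g⁽ᵐ⁾ ξ - g⁽ᵐ⁾ t) s ^ m /
m!`. The Hölder constant on `[0, 2]` serves all `t` at once. -/
lemma MemHolderClassReal.exists_taylor {α : ℝ} (hα : 0 < α) {m : ℕ} {g : ℝ → ℝ}
    (hg : MemHolderClassReal m α g) :
    ∃ q : ℝ → Polynomial ℝ, (∀ t, (q t).natDegree ≤ m) ∧ ∃ C : ℝ, ∀ t ∈ Icc (0 : ℝ) 1,
      ∀ s ∈ Icc (0 : ℝ) 1, |g (t + s) - (q t).eval s| ≤ C * s ^ (m + α) := by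
  obtain ⟨hgm, hh⟩ := hg
  obtain ⟨C, hC⟩ := hh (Icc 0 2) (subset_univ _) isCompact_Icc
  refine ⟨fun t => ∑ k ∈ Finset.range (m + 1),
    Polynomial.C ((k.factorial : ℝ)⁻¹ * iteratedDeriv k g t) * Polynomial.X ^ k, ?_, |C|, ?_⟩
  · intro t
    refine Polynomial.natDegree_sum_le_of_forall_le _ _ fun k hk => ?_
    exact (Polynomial.natDegree_C_mul_X_pow_le _ _).trans (Nat.lt_succ_iff.1 (Finset.mem_range.1 hk))
  · intro t ht s hs
    have hts : t + s ∈ Icc (0 : ℝ) 2 := ⟨by linarith [ht.1, hs.1], by linarith [ht.2, hs.2]⟩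
    have ht2 : t ∈ Icc (0 : ℝ) 2 := ⟨ht.1, by linarith [ht.2]⟩
    simp only [Polynomial.eval_finsetSum, Polynomial.eval_mul, Polynomial.eval_C,
      Polynomial.eval_pow, Polynomial.eval_X]
    rw [Real.rpow_add_of_nonneg hs.1 (Nat.cast_nonneg m) hα.le, Real.rpow_natCast]
    rcases hs.1.eq_or_lt with h0 | h0
    · subst h0
      rw [Finset.sum_range_succ']
      simp only [add_zero, pow_zero, Nat.factorial_zero, Nat.cast_one, inv_one, iteratedDeriv_zero,
        one_mul, mul_one, ne_eq, Nat.add_eq_zero_iff, one_ne_zero, and_false, not_false_eq_true,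
        zero_pow, mul_zero, Finset.sum_const_zero, zero_add, sub_self, abs_zero]
      positivity
    rw [Finset.sum_range_succ]
    have hrem : ∃ ξ ∈ Icc t (t + s), g (t + s) - ∑ k ∈ Finset.range m,
        (k.factorial : ℝ)⁻¹ * iteratedDeriv k g t * s ^ k =
        (m.factorial : ℝ)⁻¹ * iteratedDeriv m g ξ * s ^ m := by
      cases m with
      | zero => exact ⟨t + s, ⟨by linarith, le_rfl⟩, by simp⟩
      | succ m =>
        have hne : t ≠ t + s := by linarith
        have hlt : t < t + s := by linarith
        obtain ⟨ξ, hξ, he⟩ := taylor_mean_remainder_lagrange_iteratedDeriv (n := m) hne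
          (by exact_mod_cast hgm.contDiffOn)
        rw [uIoo_of_lt hlt] at hξ
        refine ⟨ξ, Ioo_subset_Icc_self hξ, ?_⟩
        rw [taylor_within_apply, add_sub_cancel_left] at he
        have hsum : ∑ k ∈ Finset.range (m + 1), (k.factorial : ℝ)⁻¹ * iteratedDeriv k g t * s ^ k =
            ∑ k ∈ Finset.range (m + 1), ((k.factorial : ℝ)⁻¹ * s ^ k) •
              iteratedDerivWithin k g (uIcc t (t + s)) t := by
          refine Finset.sum_congr rfl fun k hk => ?_
          rw [iteratedDerivWithin_eq_iteratedDeriv (uniqueDiffOn_uIcc hne)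
            (hgm.contDiffAt.of_le (by exact_mod_cast (Finset.mem_range.1 hk).le)) left_mem_uIcc,
            smul_eq_mul]
          ring
        rw [hsum, he]
        ring
    obtain ⟨ξ, hξ, he⟩ := hrem
    rw [← sub_sub, he, ← sub_mul, ← mul_sub, abs_mul, abs_mul, abs_of_pos (pow_pos h0 m)]
    have hξ2 : ξ ∈ Icc (0 : ℝ) 2 := ⟨ht.1.trans hξ.1, hξ.2.trans hts.2⟩
    have hd : dist ξ t ≤ s := by
      rw [Real.dist_eq, abs_of_nonneg (by linarith [hξ.1])]
      linarith [hξ.2]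
    have h1 : |iteratedDeriv m g ξ - iteratedDeriv m g t| ≤ |C| * s ^ α := by
      refine (hC t ht2 ξ hξ2).trans ?_
      gcongr
      exact le_abs_self C
    have h2 : |(m.factorial : ℝ)⁻¹| ≤ 1 := by
      rw [abs_of_nonneg (by positivity)]
      exact inv_le_one_of_one_le₀ (by exact_mod_cast m.factorial_pos)
    calc _ ≤ 1 * (|C| * s ^ α) * s ^ m := by gcongr
      _ = _ := by ring

/-! ### Peano polynomials along rays -/

section Peano

variable {E : Type*} [NormedAddCommGroup E] [NormedSpace ℝ E] {f : E → ℝ} {m : ℕ} {x h : E}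
  {p q : Polynomial ℝ}

/-- `p` is the one-sided Taylor–Peano polynomial of degree `m` of `s ↦ f (x + s • h)` at `0`. -/
def IsPeano (f : E → ℝ) (m : ℕ) (x h : E) (p : Polynomial ℝ) : Prop :=
  p.natDegree ≤ m ∧ (fun s : ℝ => f (x + s • h) - p.eval s) =o[𝓝[≥] (0 : ℝ)] fun s => s ^ m

lemma IsPeano.unique (hp : IsPeano f m x h p) (hq : IsPeano f m x h q) : p = q := by
  rw [← sub_eq_zero]
  refine Polynomial.eq_zero_of_isLittleO_pow (m := m)
    ((Polynomial.natDegree_sub_le_of_le hp.1 hq.1).trans (max_self m).le) ?_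
  refine (hq.2.sub hp.2).congr_left fun s => ?_
  rw [Polynomial.eval_sub]
  ring

lemma natDegree_comp_C_mul_X_le (c : ℝ) : (p.comp (Polynomial.C c * Polynomial.X)).natDegree ≤
    p.natDegree := by
  rw [Polynomial.natDegree_comp]
  exact mul_le_of_le_one_right (Nat.zero_le _) ((Polynomial.natDegree_C_mul_le c _).trans Polynomial.natDegree_X_le)

lemma IsPeano.smul (hp : IsPeano f m x h p) {c : ℝ} (hc : 0 ≤ c) :
    IsPeano f m x (c • h) (p.comp (Polynomial.C c * Polynomial.X)) := by
  refine ⟨(natDegree_comp_C_mul_X_le c).trans hp.1, ?_⟩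
  have ht : Tendsto (fun s : ℝ => c * s) (𝓝[≥] 0) (𝓝[≥] 0) := by
    refine tendsto_nhdsWithin_iff.2 ⟨?_, ?_⟩
    · have : Continuous fun s : ℝ => c * s := by fun_prop
      simpa using (this.tendsto 0).mono_left nhdsWithin_le_nhds
    · filter_upwards [self_mem_nhdsWithin] with s hs
      exact mul_nonneg hc hs
  have h1 := hp.2.comp_tendsto ht
  have h2 : (fun s : ℝ => (c * s) ^ m) =O[𝓝[≥] (0 : ℝ)] fun s => s ^ m := by
    simp only [mul_pow]
    exact (Asymptotics.isBigO_refl _ _).const_mul_left _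
  refine (h1.trans_isBigO h2).congr_left fun s => ?_
  simp only [Function.comp_apply, Polynomial.eval_comp, Polynomial.eval_mul, Polynomial.eval_C,
    Polynomial.eval_X, smul_smul, mul_comm s c]

/-- A Taylor estimate along a curve that runs through a line segment gives the Taylor–Peano
polynomial of `f` in the direction of the segment. -/
lemma isPeano_of_curve {α : ℝ} (hα : 0 < α) {c : ℝ → E} {t σ C : ℝ} {v : E} (hσ : 0 < σ)
    (hσ₁ : σ ≤ 1) (hq : q.natDegree ≤ m)
    (hT : ∀ s ∈ Icc (0 : ℝ) 1, |f (c (t + s)) - q.eval s| ≤ C * s ^ (m + α))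
    (hc : ∀ s ∈ Icc 0 σ, c (t + s) = x + s • v) : IsPeano f m x v q := by
  refine ⟨hq, isLittleO_pow_of_eventually_le_rpow hα (C := C) ?_⟩
  filter_upwards [self_mem_nhdsWithin, mem_nhdsWithin_of_mem_nhds (Iic_mem_nhds hσ)] with s hs hs'
  rw [← hc s ⟨hs, hs'⟩]
  exact hT s ⟨hs, hs'.trans hσ₁⟩

/-- A locally uniform Taylor estimate along lines forces the homogeneous sum of the line-wise Taylor
polynomials at a point to be a polynomial function on every line. -/
lemma interpolatedOnLines_of_isPeano {α : ℝ} (hα : 0 < α) {U : Set E} (hU : IsOpen U)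
    {p : E → E → Polynomial ℝ} (hp : ∀ x ∈ U, ∀ h, IsPeano f m x h (p x h)) {x : E} (hx : x ∈ U)
    (hT : ∃ r > 0, ∃ C : ℝ, ∀ y ∈ Metric.ball x r, ∀ h, ‖h‖ ≤ r →
      |f (y + h) - (p y h).eval 1| ≤ C * ‖h‖ ^ (m + α)) :
    InterpolatedOnLines m fun h => (p x h).eval 1 := by
  obtain ⟨r, hr, C, hC⟩ := hT
  intro h v s
  -- With base point `x + t • k₀`, the point `x + t • (h + σ • v)` lies at displacement `(t * (σ +
  -- |s|)) • v`. The shift by `|s|` makes this factor nonnegative for `σ = s` and at all nodes, as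
  -- one-sided expansions require.
  set k₀ := h - |s| • v with hk₀
  have herr : ∀ σ : ℝ, 0 ≤ σ + |s| →
      (fun t : ℝ => f (x + t • (h + σ • v)) - (p (x + t • k₀) v).eval (t * (σ + |s|)))
        =o[𝓝[≥] (0 : ℝ)] fun t => t ^ m := by
    intro σ hσ
    refine isLittleO_pow_of_eventually_le_rpow hα (C := C * ((σ + |s|) * ‖v‖) ^ (m + α)) ?_
    have hy : Tendsto (fun t : ℝ => x + t • k₀) (𝓝[≥] 0) (𝓝 x) := by
      have : Continuous fun t : ℝ => x + t • k₀ := by fun_prop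
      simpa using (this.tendsto 0).mono_left nhdsWithin_le_nhds
    have hz : Tendsto (fun t : ℝ => (t * (σ + |s|)) • v) (𝓝[≥] 0) (𝓝 0) := by
      have : Continuous fun t : ℝ => (t * (σ + |s|)) • v := by fun_prop
      simpa using (this.tendsto 0).mono_left nhdsWithin_le_nhds
    filter_upwards [hy (hU.mem_nhds hx), hy (Metric.ball_mem_nhds x hr),
      hz (Metric.closedBall_mem_nhds 0 hr), self_mem_nhdsWithin] with t h1 h2 h3 h4
    have h4 : 0 ≤ t := h4
    have hts : 0 ≤ t * (σ + |s|) := mul_nonneg h4 hσ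
    have h5 := hC _ h2 _ (by simpa using h3)
    -- By homogeneity the approximation becomes a polynomial in `σ` of degree at most `m`.
    rw [(hp _ h1 _).unique ((hp _ h1 v).smul hts)] at h5
    simp only [Polynomial.eval_comp, Polynomial.eval_mul, Polynomial.eval_C, Polynomial.eval_X,
      mul_one] at h5
    have e : x + t • k₀ + (t * (σ + |s|)) • v = x + t • (h + σ • v) := by
      rw [hk₀]
      module
    rw [e, norm_smul, Real.norm_of_nonneg hts] at h5
    refine h5.trans (le_of_eq ?_)
    rw [mul_assoc t, Real.mul_rpow h4 (by positivity)]
    ring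
  have hpx : ∀ σ : ℝ, (fun t : ℝ => f (x + t • (h + σ • v)) - (p x (h + σ • v)).eval t)
      =o[𝓝[≥] (0 : ℝ)] fun t => t ^ m := fun σ => (hp x hx _).2
  have hdiff : ∀ σ : ℝ, 0 ≤ σ + |s| →
      (fun t : ℝ => (p x (h + σ • v)).eval t - (p (x + t • k₀) v).eval (t * (σ + |s|)))
        =o[𝓝[≥] (0 : ℝ)] fun t => t ^ m := fun σ hσ =>
    ((herr σ hσ).sub (hpx σ)).congr_left fun t => by ring
  -- Interpolation is exact for the comparison polynomials, so the defect is `o(t ^ m)`; having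
  -- degree at most `m` in `t`, it vanishes.
  have hzero : p x (h + s • v) - ∑ j ∈ Finset.range (m + 1),
      Polynomial.C (lagrangeWeight m j s) * p x (h + (j : ℝ) • v) = 0 := by
    refine Polynomial.eq_zero_of_isLittleO_pow (m := m) ?_ ?_
    · refine (Polynomial.natDegree_sub_le_of_le (n := m) (hp x hx _).1 ?_).trans (max_self m).le
      exact Polynomial.natDegree_sum_le_of_forall_le _ _ fun j _ =>
        (Polynomial.natDegree_C_mul_le _ _).trans (hp x hx _).1
    · have h1 := hdiff s (by linarith [neg_abs_le s])
      have h2 := Asymptotics.IsLittleO.fun_sum (s := Finset.range (m + 1)) fun j _ =>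
        (hdiff j (by positivity)).const_mul_left (lagrangeWeight m j s)
      have hU' : ∀ᶠ t in 𝓝[≥] (0 : ℝ), x + t • k₀ ∈ U := by
        have : Continuous fun t : ℝ => x + t • k₀ := by fun_prop
        have := (this.tendsto 0).mono_left (nhdsWithin_le_nhds (s := Ici (0 : ℝ)))
        rw [zero_smul, add_zero] at this
        exact this (hU.mem_nhds hx)
      refine (h1.sub h2).congr' ?_ EventuallyEq.rfl
      filter_upwards [hU'] with t ht
      have hdeg : ((p (x + t • k₀) v).comp
          (Polynomial.C t * (Polynomial.X + Polynomial.C |s|))).natDegree ≤ m := by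
        rw [show (p (x + t • k₀) v).comp (Polynomial.C t * (Polynomial.X + Polynomial.C |s|)) =
          ((p (x + t • k₀) v).comp (Polynomial.C t * Polynomial.X)).comp
            (Polynomial.X + Polynomial.C |s|) by simp [Polynomial.comp_assoc],
          Polynomial.natDegree_comp, Polynomial.natDegree_X_add_C, mul_one]
        exact (natDegree_comp_C_mul_X_le t).trans (hp _ ht v).1
      have hL := eval_eq_sum_lagrangeWeight hdeg s
      simp only [Polynomial.eval_comp, Polynomial.eval_mul, Polynomial.eval_C, Polynomial.eval_X,
        Polynomial.eval_add] at hL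
      simp only [Polynomial.eval_sub, Polynomial.eval_finsetSum, Polynomial.eval_mul,
        Polynomial.eval_C, mul_sub, Finset.sum_sub_distrib]
      rw [hL]
      ring
  have := congrArg (Polynomial.eval 1) hzero
  simp only [Polynomial.eval_sub, Polynomial.eval_finsetSum, Polynomial.eval_mul,
    Polynomial.eval_C, Polynomial.eval_zero, sub_eq_zero] at this
  exact this

end Peano

/-! ### From smooth curves to uniform Taylor approximation -/

section Curves

variable {E : Type*} [NormedAddCommGroup E] [NormedSpace ℝ E] [CompleteSpace E] {U : Set E}
  {f : E → ℝ} {m : ℕ} {α : ℝ}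

/-- Only the segment at parameter `1` (index `n = 0`) is used; homogeneity then restores the length
of `h`. -/
lemma exists_isPeano (hα : 0 < α) (hU : IsOpen U)
    (H : ∀ c : ℝ → E, ContDiff ℝ ∞ c → (∀ t, c t ∈ U) → MemHolderClassReal m α (f ∘ c))
    {x : E} (hx : x ∈ U) (h : E) : ∃ p, IsPeano f m x h p := by
  obtain ⟨B, hB, hcurve⟩ := exists_smooth_curve_through_segments E
  obtain ⟨ρ, hρ, hρU⟩ := Metric.isOpen_iff.1 hU x hx
  -- Keeps the curve within `ρ / 2` of `x`, hence in `U`.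
  set ε := ρ / (2 * B) with hεd
  have hε : 0 < ε := by positivity
  have hu : ‖‖h‖⁻¹ • h‖ ≤ 1 := by
    rw [norm_smul, norm_inv, norm_norm]
    exact inv_mul_le_one
  obtain ⟨c, hc, hcb, hcs⟩ := hcurve x ε hε (fun _ => 0) (fun _ => ‖h‖⁻¹ • h) (by simp)
    (fun _ => hu)
  have hcU : ∀ t, c t ∈ U := by
    intro t
    refine hρU (mem_ball_iff_norm.2 ((hcb t).trans_lt ?_))
    rw [hεd]
    field_simp
    linarith
  obtain ⟨q, hq, C, hC⟩ := (H c hc hcU).exists_taylor hα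
  have hP : IsPeano f m x (ε • ‖h‖⁻¹ • h) (q 1) := by
    refine isPeano_of_curve hα (c := c) (t := 1) (σ := 1 / 8) (by norm_num) (by norm_num) (hq 1)
      (hC 1 (by simp)) fun s hs => ?_
    have := hcs 0 s (by simpa using hs)
    simpa [smul_smul, mul_comm, mul_left_comm, mul_assoc] using this
  have hP' := hP.smul (c := ‖h‖ / ε) (by positivity)
  have e : (‖h‖ / ε) • ε • ‖h‖⁻¹ • h = h := by
    rcases eq_or_ne h 0 with rfl | h0
    · simp
    have : ‖h‖ ≠ 0 := norm_ne_zero_iff.2 h0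
    rw [smul_smul, smul_smul]
    field_simp
    simp
  rw [e] at hP'
  exact ⟨_, hP'⟩

lemma exists_uniform_taylor_bound (hα : 0 < α) (hU : IsOpen U)
    (H : ∀ c : ℝ → E, ContDiff ℝ ∞ c → (∀ t, c t ∈ U) → MemHolderClassReal m α (f ∘ c))
    {p : E → E → Polynomial ℝ} (hp : ∀ x ∈ U, ∀ h, IsPeano f m x h (p x h)) {x₀ : E}
    (hx₀ : x₀ ∈ U) : ∃ r > 0, ∃ C : ℝ, ∀ x ∈ Metric.ball x₀ r, ∀ h, ‖h‖ ≤ r →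
      |f (x + h) - (p x h).eval 1| ≤ C * ‖h‖ ^ (m + α) := by
  by_contra! hcon
  obtain ⟨B, hB, hcurve⟩ := exists_smooth_curve_through_segments E
  obtain ⟨ρ, hρ, hρU⟩ := Metric.isOpen_iff.1 hU x₀ hx₀
  set ε := ρ / (2 * B) with hεd
  have hε : 0 < ε := by positivity
  set a : ℕ → ℝ := fun n => ε * (n.factorial : ℝ)⁻¹ with had
  have ha : ∀ n, 0 < a n := fun n => by positivity
  set σ : ℕ → ℝ := fun n => (8 * 2 ^ n : ℝ)⁻¹ with hσd
  have hσ : ∀ n, 0 < σ n := fun n => by positivity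
  have hσ1 : ∀ n, σ n ≤ 1 := fun n => by
    have : (1 : ℝ) ≤ 2 ^ n := one_le_pow₀ (by norm_num)
    exact inv_le_one_of_one_le₀ (by linarith)
  have hmul : ∀ n, 0 < a n * σ n := fun n => mul_pos (ha n) (hσ n)
  -- The radius lets segment `n` of the curve start at `x n` and reach `x n + h n` at parameter `l =
  -- ‖h n‖ / a n ≤ σ n`. The factor `(a n)⁻¹ ^ (m + α)` makes the violated bound `n * l ^ (m + α)`,
  -- contradicting the curve's constant `C` once `n ≥ C`.
  choose x hx h hh hbad using fun n : ℕ =>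
    hcon (min (a n * σ n) ρ) (lt_min (hmul n) hρ) (n * (a n)⁻¹ ^ (m + α))
  have hxU : ∀ n, x n ∈ U := fun n => hρU (Metric.ball_subset_ball (min_le_right _ _) (hx n))
  have hy : ∀ n, ‖(a n)⁻¹ • (x n - x₀)‖ ≤ 1 := by
    intro n
    have h1 : ‖x n - x₀‖ ≤ a n := ((mem_ball_iff_norm.1 (hx n)).le.trans (min_le_left _ _)).trans
      (mul_le_of_le_one_right (ha n).le (hσ1 n))
    rw [norm_smul, norm_inv, Real.norm_of_nonneg (ha n).le]
    exact inv_mul_le_one_of_le₀ h1 (ha n).le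
  have hu : ∀ n, ‖‖h n‖⁻¹ • h n‖ ≤ 1 := by
    intro n
    rw [norm_smul, norm_inv, norm_norm]
    exact inv_mul_le_one
  obtain ⟨c, hc, hcb, hcs⟩ := hcurve x₀ ε hε _ _ hy hu
  have hcU : ∀ t, c t ∈ U := by
    intro t
    refine hρU (mem_ball_iff_norm.2 ((hcb t).trans_lt ?_))
    rw [hεd]
    field_simp
    linarith
  obtain ⟨q, hq, C, hC⟩ := (H c hc hcU).exists_taylor hα
  obtain ⟨n, hn⟩ := exists_nat_ge C
  have ht : (2 ^ n : ℝ)⁻¹ ∈ Icc (0 : ℝ) 1 :=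
    ⟨by positivity, inv_le_one_of_one_le₀ (one_le_pow₀ (by norm_num))⟩
  have hseg : ∀ s ∈ Icc 0 (σ n), c ((2 ^ n)⁻¹ + s) = x n + s • a n • ‖h n‖⁻¹ • h n := by
    intro s hs
    rw [hcs n s hs]
    change x₀ + a n • _ = _
    rw [smul_add, smul_smul (a n) (a n)⁻¹, mul_inv_cancel₀ (ha n).ne', one_smul, ← add_assoc,
      add_sub_cancel, smul_comm s (a n)]
  have hP := isPeano_of_curve hα (hσ n) (hσ1 n) (hq _) (hC _ ht) hseg
  set l := ‖h n‖ / a n with hl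
  have hl0 : 0 ≤ l := div_nonneg (norm_nonneg _) (ha n).le
  have hlσ : l ≤ σ n := by
    rw [hl, div_le_iff₀ (ha n), mul_comm]
    exact (hh n).trans (min_le_left _ _)
  have e : l • a n • ‖h n‖⁻¹ • h n = h n := by
    rcases eq_or_ne (h n) 0 with h0 | h0
    · simp [h0]
    have h1 : ‖h n‖ ≠ 0 := norm_ne_zero_iff.2 h0
    have h2 := (ha n).ne'
    rw [hl, smul_smul, smul_smul, div_mul_cancel₀ _ h2, mul_inv_cancel₀ h1, one_smul]
  have hP' := hP.smul hl0
  rw [e] at hP'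
  have h1 := hC _ ht l ⟨hl0, hlσ.trans (hσ1 n)⟩
  have h2 := hbad n
  rw [(hp _ (hxU n) (h n)).unique hP'] at h2
  rw [Function.comp_apply, hseg l ⟨hl0, hlσ⟩, e] at h1
  simp only [Polynomial.eval_comp, Polynomial.eval_mul, Polynomial.eval_C, Polynomial.eval_X,
    mul_one] at h2
  rw [mul_assoc, ← Real.mul_rpow (inv_nonneg.2 (ha n).le) (norm_nonneg _), inv_mul_eq_div,
    ← hl] at h2
  have h3 : C * l ^ (m + α) ≤ n * l ^ (m + α) := by gcongr
  linarith

lemma exists_taylorApprox (hα : 0 < α) (hU : IsOpen U)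
    (H : ∀ c : ℝ → E, ContDiff ℝ ∞ c → (∀ t, c t ∈ U) → MemHolderClassReal m α (f ∘ c)) :
    ∃ P, TaylorApprox m m α U f P := by
  classical
  have hex : ∀ x h : E, ∃ p, x ∈ U → IsPeano f m x h p := fun x h => by
    by_cases hx : x ∈ U
    · exact (exists_isPeano hα hU H hx h).imp fun p hp _ => hp
    · exact ⟨0, fun h => absurd h hx⟩
  choose p hp using hex
  have hp' : ∀ x ∈ U, ∀ h, IsPeano f m x h (p x h) := fun x hx h => hp x h hx
  have hT := fun x₀ (hx₀ : x₀ ∈ U) => exists_uniform_taylor_bound hα hU H hp' hx₀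
  exact ⟨fun x h => (p x h).eval 1,
    fun x hx => interpolatedOnLines_of_isPeano hα hU hp' hx (hT x hx), hT⟩

end Curves

theorem theorem1p2 (d m : ℕ) (α : ℝ) (hα₀ : 0 < α) (hα₁ : α ≤ 1)
    (U : Set (EuclideanSpace ℝ (Fin d))) (hU : IsOpen U)
    (f : EuclideanSpace ℝ (Fin d) → ℝ) :
    (∀ c : ℝ → EuclideanSpace ℝ (Fin d), ContDiff ℝ ∞ c → (∀ t, c t ∈ U) →
        MemHolderClassReal m α (f ∘ c)) ↔
      MemHolderClassOn m α U f := by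
  constructor
  · intro H
    obtain ⟨P, hP⟩ := exists_taylorApprox hα₀ hU H
    exact (memHolderClassOn_iff hα₀ hU).2 (hP.holderDiff hα₀ hα₁ hU)
  · intro hf c hc hcU
    exact (memHolderClassReal_iff hα₀).2
      (((memHolderClassOn_iff hα₀ hU).1 hf).comp_curve hα₀ hα₁ hU hc hcU)
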